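/- Let $\mathbb H$ be a real separable Hilbert space with its Borel $\sigma$-algebra, let $\sigma>0$, let $k(x,y)=e^{-\sigma\|x-y\|^2}$ be the Gaussian kernel on $\mathbb H$, and let $\mathcal H_k$ be its reproducing kernel Hilbert space. For a positive (self-adjoint, positive semidefinite) trace-class operator $A$ on $\mathbb H$ let $|I+A|=\prod_j(1+\lambda_j)$, where $(\lambda_j)$ are the nonzero eigenvalues of $A$, each repeated according to its (finite) multiplicity; this product converges. For $\mu\in\mathbb H$ and a bounded positive operator $C$ on $\mathbb H$, a Borel measure $P$ on $\mathbb H$ is called $\mathcal N(\mu,C)$ if for every $a\in\mathbb H$ the law of $y\mapsto\langle a,y\rangle$ under $P$ is $N(\langle a,\mu\rangle,\langle Ca,a\rangle)$. Write $m_P=\int k(\cdot,y)\,P(dy)\in\mathcal H_k$ for the kernel mean embedding of $P$ and $$\mathrm{MMD}(P,Q)=\sup_{f\in\mathcal H_k,\ \|f\|_{\mathcal H_k}\le 1}\Big(\int f\,dP-\int f\,dQ\Big).$$ 1. The map $A\mapsto|I+A|^{-1/2}$ is strictly convex on the convex set of positive trace-class operators on $\mathbb H$. 2. If $P=\mathcal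 N(\mu,C)$, then $C$ is trace class, $I+2\sigma C$ is invertible, the integral defining $m_P$ exists as a Bochner integral in $\mathcal H_k$, and for every $x\in\mathbb H$ $$m_P(x)=\int_{\mathbb H}e^{-\sigma\|x-y\|^2}\,P(dy)=|I+2\sigma C|^{-1/2}\,e^{-\sigma\langle (I+2\sigma C)^{-1}(x-\mu),\,x-\mu\rangle},\qquad \|m_P\|_{\mathcal H_k}^2=|I+4\sigma C|^{-1/2}.$$ 3. If $P_1=\mathcal N(\mu_1,C_1)$ and $P_2=\mathcal N(\mu_2,C_2)$, then $I+2\sigma(C_1+C_2)$ is invertible, $\mathrm{MMD}(P_1,P_2)=\|m_{P_1}-m_{P_2}\|_{\mathcal H_k}$, and $$\|m_{P_1}-m_{P_2}\|_{\mathcal H_k}^2=|I+4\sigma C_1|^{-1/2}+|I+4\sigma C_2|^{-1/2}-2\,|I+2\sigma(C_1+C_2)|^{-1/2}\,e^{-\sigma\langle (I+2\sigma(C_1+C_2))^{-1}(\mu_1-\mu_2),\,\mu_1-\mu_2\rangle}.$$ 4. The kernel mean embedding $P\mapsto m_P$ is injective on the set of all Gaussian measures $\mathcal N(\mu,C)$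 on $\mathbb H$. -/

import Mathlib

open MeasureTheory ProbabilityTheory
open scoped RealInnerProductSpace

section KernelMeanEmbedding

/-- `P = N(μ, C)` on a real Hilbert space: `C` is a bounded, self-adjoint, positive semidefinite
operator and, for every `a`, the law of `y ↦ ⟨a, y⟩` under `P` is `N(⟨a, μ⟩, ⟨C a, a⟩)`
(a point mass when the variance vanishes). No trace-class assumption is made on `C`. -/
def IsGaussianWith {H : Type*} [NormedAddCommGroup H] [InnerProductSpace ℝ H] [CompleteSpace H]
    [MeasurableSpace H] (P : Measure H) (μ : H) (C : H →L[ℝ] H) : Prop :=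
  C.IsPositive ∧
    ∀ a : H, P.map (fun y => ⟪a, y⟫) = gaussianReal ⟪a, μ⟫ (Real.toNNReal ⟪C a, a⟫)

/-- Positive (self-adjoint, positive semidefinite) trace-class operators: the trace
`∑ᵢ ⟨A bᵢ, bᵢ⟩` converges along every Hilbert basis `b`. -/
def IsPosTraceClass {H : Type*} [NormedAddCommGroup H] [InnerProductSpace ℝ H] [CompleteSpace H]
    (A : H →L[ℝ] H) : Prop :=
  A.IsPositive ∧
    ∀ (s : Set H) (b : HilbertBasis s ℝ H), Summable fun i : s => ⟪A (b i), b i⟫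

/-- The multiplicity of the real number `t` as an eigenvalue of `A`: the dimension of
`ker (A - t)`, which is `0` if `t` is not an eigenvalue. -/
noncomputable def eigenMult {H : Type*} [NormedAddCommGroup H] [InnerProductSpace ℝ H]
    (A : H →L[ℝ] H) (t : ℝ) : ℕ :=
  Module.finrank ℝ (Module.End.eigenspace (A : H →ₗ[ℝ] H) t)

/-- The determinant `|I + A|` of `I + A` for a positive trace-class `A`: the product of `1 + t`
over the eigenvalues `t` of `A`, counted with multiplicity. Numbers `t` that are not eigenvalues,
and `t = 0`, contribute the factor `1`. -/
noncomputable def detOneAdd {H : Type*} [NormedAddCommGroup H] [InnerProductSpace ℝ H]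
    (A : H →L[ℝ] H) : ℝ :=
  ∏' t : ℝ, (1 + t) ^ eigenMult A t

/-- The Gaussian kernel `k(x, y) = exp (-σ ‖x - y‖²)`. -/
noncomputable def gaussK {H : Type*} [NormedAddCommGroup H] (σ : ℝ) (x y : H) : ℝ :=
  Real.exp (-σ * ‖x - y‖ ^ 2)

/-- The Gaussian kernel in the form used by `RKHS`: an infinite matrix with entries in
`ℝ →L[ℝ] ℝ`. -/
noncomputable def gaussKMatrix (H : Type*) [NormedAddCommGroup H] (σ : ℝ) :
    Matrix H H (ℝ →L[ℝ] ℝ) :=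
  Matrix.of fun x y => gaussK σ x y • ContinuousLinearMap.id ℝ ℝ

theorem posSemidef_inner_pow {H ι : Type*} [NormedAddCommGroup H] [InnerProductSpace ℝ H]
    [Finite ι] (p : ι → H) (n : ℕ) :
    (Matrix.of fun i j : ι => ⟪p i, p j⟫ ^ n).PosSemidef := by
  have hg : (Matrix.gram ℝ p).PosSemidef := Matrix.posSemidef_gram ℝ _
  induction n with
  | zero =>
    have h1 : (Matrix.gram ℝ (fun _ : ι => (1 : ℝ))).PosSemidef := Matrix.posSemidef_gram ℝ _
    have he : (Matrix.of fun i j : ι => ⟪p i, p j⟫ ^ 0) = Matrix.gram ℝ (fun _ : ι => (1 : ℝ)) := by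
      ext x y
      simp [Matrix.gram]
    rw [he]
    exact h1
  | succ n ih =>
    have he : (Matrix.of fun i j : ι => ⟪p i, p j⟫ ^ (n + 1)) =
        (Matrix.of fun i j : ι => ⟪p i, p j⟫ ^ n).hadamard (Matrix.gram ℝ p) := by
      ext x y
      simp [Matrix.gram, pow_succ]
    rw [he]
    exact ih.hadamard hg

theorem gaussK_sum_nonneg {H : Type*} [NormedAddCommGroup H] [InnerProductSpace ℝ H] {σ : ℝ}
    (hσ : 0 ≤ σ) (s : Finset H) (a : H → ℝ) :
    0 ≤ ∑ x ∈ s, ∑ y ∈ s, a x * gaussK σ x y * a y := by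
  have key : ∀ w : H → ℝ,
      0 ≤ ∑ x ∈ s, ∑ y ∈ s, w x * Real.exp (2 * σ * ⟪x, y⟫) * w y := by
    intro w
    have hs : HasSum (fun n : ℕ => (2 * σ) ^ n / (n.factorial : ℝ) *
        (∑ x ∈ s, ∑ y ∈ s, w x * ⟪x, y⟫ ^ n * w y))
        (∑ x ∈ s, ∑ y ∈ s, w x * Real.exp (2 * σ * ⟪x, y⟫) * w y) := by
      simp only [Finset.mul_sum]
      refine hasSum_sum fun x _ => hasSum_sum fun y _ => ?_
      have h := NormedSpace.expSeries_div_hasSum_exp (2 * σ * ⟪x, y⟫)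
      rw [← Real.exp_eq_exp_ℝ] at h
      have h2 := (h.mul_left (w x)).mul_right (w y)
      refine h2.congr_fun ?_
      intro n
      rw [mul_pow]
      ring
    refine hs.nonneg fun n => mul_nonneg (by positivity) ?_
    have h := (posSemidef_inner_pow (fun i : s => (i : H)) n).dotProduct_mulVec_nonneg
      (fun i : s => w i)
    simp only [dotProduct, Matrix.mulVec, Finset.mul_sum] at h
    rw [← Finset.sum_coe_sort s]
    refine h.trans_eq (Finset.sum_congr rfl fun x _ => ?_)
    rw [← Finset.sum_coe_sort s]
    refine Finset.sum_congr rfl fun y _ => ?_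
    simp
    ring
  refine (key fun x => a x * Real.exp (-σ * ‖x‖ ^ 2)).trans_eq
    (Finset.sum_congr rfl fun x _ => Finset.sum_congr rfl fun y _ => ?_)
  have he : gaussK σ x y = Real.exp (-σ * ‖x‖ ^ 2) * Real.exp (2 * σ * ⟪x, y⟫) *
      Real.exp (-σ * ‖y‖ ^ 2) := by
    rw [gaussK, ← Real.exp_add, ← Real.exp_add, norm_sub_sq_real]
    congr 1
    ring
  rw [he]
  ring

/-- The Gaussian kernel is positive semidefinite. -/
theorem posSemidef_gaussKMatrix (H : Type*) [NormedAddCommGroup H] [InnerProductSpace ℝ H] {σ : ℝ}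
    (hσ : 0 ≤ σ) : (gaussKMatrix H σ).PosSemidef := by
  have h := (RKHS.posSemidef_tfae (𝕜 := ℝ) (K := gaussKMatrix H σ)).out 0 2
  refine h.2 ⟨?_, fun v => ?_⟩
  · have hid : star (ContinuousLinearMap.id ℝ ℝ) = ContinuousLinearMap.id ℝ ℝ :=
      star_one (ℝ →L[ℝ] ℝ)
    ext x y
    simp [gaussKMatrix, gaussK, norm_sub_rev, hid]
  · refine (gaussK_sum_nonneg hσ v.support v).trans_eq ?_
    simp only [Finsupp.sum, RCLike.re_to_real]
    refine Finset.sum_congr rfl fun x _ => Finset.sum_congr rfl fun y _ => ?_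
    simp [gaussKMatrix, gaussK, norm_sub_rev x y]
    ring

instance instFactPosSemidefGaussKMatrix (H : Type*) [NormedAddCommGroup H] [InnerProductSpace ℝ H]
    (σ : ℝ) [hσ : Fact (0 < σ)] : Fact (gaussKMatrix H σ).PosSemidef :=
  ⟨posSemidef_gaussKMatrix H hσ.out.le⟩

/-- The reproducing kernel Hilbert space of the Gaussian kernel on `H`. -/
abbrev GaussRKHS (H : Type*) [NormedAddCommGroup H] [InnerProductSpace ℝ H]
    (σ : ℝ) [Fact (0 < σ)] : Type _ :=
  RKHS.OfKernel (gaussKMatrix H σ)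

/-- The feature map `y ↦ k(·, y)` into the Gaussian RKHS. -/
noncomputable def gaussFeature {H : Type*} [NormedAddCommGroup H] [InnerProductSpace ℝ H]
    (σ : ℝ) [Fact (0 < σ)] (y : H) : GaussRKHS H σ :=
  RKHS.kerFun (GaussRKHS H σ) y 1

/-- The kernel mean embedding `m_P = ∫ k(·, y) P(dy)`, a Bochner integral in the Gaussian RKHS. -/
noncomputable def kernelMean {H : Type*} [NormedAddCommGroup H] [InnerProductSpace ℝ H]
    [MeasurableSpace H] (σ : ℝ) [Fact (0 < σ)] (P : Measure H) : GaussRKHS H σ :=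
  ∫ y, gaussFeature σ y ∂P

/-- The maximum mean discrepancy: the supremum of `∫ f dP - ∫ f dQ` over the unit ball of the
Gaussian RKHS. -/
noncomputable def gaussMMD {H : Type*} [NormedAddCommGroup H] [InnerProductSpace ℝ H]
    [MeasurableSpace H] (σ : ℝ) [Fact (0 < σ)] (P Q : Measure H) : ℝ :=
  ⨆ f : {f : GaussRKHS H σ // ‖f‖ ≤ 1}, ((∫ x, f.1 x ∂P) - ∫ x, f.1 x ∂Q)

end KernelMeanEmbedding

/-! ### Spectral decomposition of positive trace-class operators -/

section Spectral

open Filter Topology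

variable {H : Type*} [NormedAddCommGroup H] [InnerProductSpace ℝ H]

/-! Write `F A` for `|I + A|^{-1/2}`. A positive trace-class operator is Hilbert–Schmidt, hence
compact, hence diagonal in a Hilbert basis, so `F A = exp (-½ ∑ log (1 + λᵢ))`.

Strict convexity: expand everything in an eigenbasis `e` of `M = pA + qB`. The eigenvalues of `M`
are `p αᵢ + q βᵢ`, with `α`, `β` the diagonals of `A`, `B` in `e`. Concavity of `log` and convexity
of `exp` bound `F M` by the convex combination of the values built from `α` and `β`, and Hadamard's
inequality `|I + A| ≤ ∏ (1 + αᵢ)` bounds those by `F A` and `F B`. Equality forces `α = β` and then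
`A` diagonal in `e`, hence `A = B`.

Gaussian integrals: the coordinates of `N(μ, C)` in an eigenbasis of `C` are independent, so the
integral of the kernel is a limit of products of one-dimensional integrals. The inner product of two
kernel means is the integral of `exp (-σ‖z‖²)` under the law of the difference of independent
samples, again Gaussian, so the same formula yields norms and MMD.

Injectivity: the squared distance of two embeddings is at least twice the midpoint convexity gap of
`F` between `4σC₁` and `4σC₂`. If it vanishes, strict convexity gives `C₁ = C₂`, and the remaining
exponential factor gives `μ₁ = μ₂`. -/

theorem HilbertBasis.hasSum_inner_sq {ι : Type*} (b : HilbertBasis ι ℝ H) (x : H) :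
    HasSum (fun i => ⟪b i, x⟫ ^ 2) (‖x‖ ^ 2) := by
  have h := b.hasSum_inner_mul_inner x x
  rw [real_inner_self_eq_norm_sq] at h
  refine h.congr_fun fun i => ?_
  rw [real_inner_comm, sq]

theorem HilbertBasis.eq_of_inner_eq {ι : Type*} (b : HilbertBasis ι ℝ H) {x y : H}
    (h : ∀ i, ⟪b i, x⟫ = ⟪b i, y⟫) : x = y := by
  have h0 := b.hasSum_inner_sq (x - y)
  simp only [inner_sub_right, h, sub_self, ne_eq, OfNat.ofNat_ne_zero, not_false_eq_true,
    zero_pow] at h0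
  have := h0.unique hasSum_zero
  exact sub_eq_zero.1 (norm_eq_zero.1 (by simpa using this))

theorem ContinuousLinearMap.IsPositive.inner_symm {A : H →L[ℝ] H} (hA : A.IsPositive) (x y : H) :
    ⟪A x, y⟫ = ⟪x, A y⟫ := hA.inner_left_eq_inner_right x y

/-- Cauchy–Schwarz for the semi-inner product `⟪A x, y⟫`, applied to `x` and `A x`. Along a Hilbert
basis it turns a finite trace into a finite Hilbert–Schmidt norm. -/
theorem ContinuousLinearMap.IsPositive.norm_apply_sq_le {A : H →L[ℝ] H} (hA : A.IsPositive)
    (x : H) : ‖A x‖ ^ 2 ≤ ‖A‖ * ⟪A x, x⟫ := by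
  have key := LinearMap.BilinForm.apply_sq_le_of_symm
    ((innerₗ H).comp (A : H →ₗ[ℝ] H)) (fun x => by simpa using hA.inner_nonneg_left x)
    ⟨fun x y => by simpa [real_inner_comm] using hA.inner_symm x y⟩ x (A x)
  simp only [LinearMap.comp_apply, innerₗ_apply_apply, ContinuousLinearMap.coe_coe] at key
  rw [real_inner_self_eq_norm_sq] at key
  have h1 : ⟪A (A x), A x⟫ ≤ ‖A‖ * ‖A x‖ ^ 2 := by
    calc ⟪A (A x), A x⟫ ≤ ‖A (A x)‖ * ‖A x‖ := real_inner_le_norm _ _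
      _ ≤ (‖A‖ * ‖A x‖) * ‖A x‖ := by gcongr; exact A.le_opNorm _
      _ = _ := by ring
  have h0 := hA.inner_nonneg_left x
  rcases (sq_nonneg ‖A x‖).eq_or_lt with h | h
  · rw [← h]; positivity
  · refine le_of_mul_le_mul_right ?_ h
    nlinarith [mul_le_mul_of_nonneg_left h1 h0]

/-- An operator with `∑ ‖A bᵢ‖² < ∞` along a Hilbert basis is compact. -/
theorem isCompactOperator_of_summable_norm_sq [CompleteSpace H] {ι : Type*}
    (b : HilbertBasis ι ℝ H) (A : H →L[ℝ] H) (hA : Summable fun i => ‖A (b i)‖ ^ 2) :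
    IsCompactOperator A := by
  classical
  let F : Finset ι → H →L[ℝ] H := fun s => ∑ i ∈ s, (innerSL ℝ (b i)).smulRight (A (b i))
  have hF : ∀ s, IsCompactOperator (F s) := by
    intro s
    have h1 : ∀ i, IsCompactOperator ((innerSL ℝ (b i)).smulRight (A (b i))) := fun i =>
      (isCompactOperator_of_locallyCompactSpace_dom (innerSL ℝ (b i))).clm_comp
        ((ContinuousLinearMap.id ℝ ℝ).smulRight (A (b i)))
    exact (compactOperator (RingHom.id ℝ) H H).sum_mem fun i _ => h1 i
  refine isCompactOperator_of_tendsto (F := F) (l := atTop) ?_ (Eventually.of_forall hF)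
  rw [Metric.tendsto_atTop]
  intro ε hε
  -- `F s` is a finite-rank truncation of `A`. Cauchy–Schwarz and Bessel bound `‖(A - F s) x‖` by
  -- `‖x‖` times the square root of a tail of `∑ ‖A bᵢ‖²`; taking `ε / 2` leaves room for the strict
  -- inequality.
  obtain ⟨s₀, hs₀⟩ := summable_iff_vanishing_norm.1 hA ((ε / 2) ^ 2) (by positivity)
  refine ⟨s₀, fun s hs => ?_⟩
  rw [dist_eq_norm']
  refine lt_of_le_of_lt (ContinuousLinearMap.opNorm_le_bound _ (by positivity) fun x => ?_)
    (half_lt_self hε)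
  have hx : HasSum (fun i => ⟪b i, x⟫ • A (b i)) (A x) := by
    have h := (b.hasSum_repr x).mapL A
    simpa [HilbertBasis.repr_apply_apply] using h
  have ht : Tendsto (fun t : Finset ι => ‖∑ i ∈ t, ⟪b i, x⟫ • A (b i) - F s x‖) atTop
      (𝓝 ‖(A - F s) x‖) := by
    have h : Tendsto (fun t : Finset ι => ∑ i ∈ t, ⟪b i, x⟫ • A (b i)) atTop (𝓝 (A x)) := hx
    exact (h.sub_const _).norm
  refine le_of_tendsto ht (eventually_atTop.2 ⟨s, fun t hst => ?_⟩)
  have he : ∑ i ∈ t, ⟪b i, x⟫ • A (b i) - F s x = ∑ i ∈ t \ s, ⟪b i, x⟫ • A (b i) := by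
    rw [← Finset.sum_sdiff hst]
    simp [F]
  rw [he]
  refine abs_le_of_sq_le_sq' ?_ (by positivity) |>.2
  have h1 : ∑ i ∈ t \ s, ‖A (b i)‖ ^ 2 ≤ (ε / 2) ^ 2 := by
    have := hs₀ (t \ s) (Finset.disjoint_of_subset_right hs Finset.sdiff_disjoint)
    exact ((le_abs_self _).trans_lt this).le
  have h2 : ∑ i ∈ t \ s, |⟪b i, x⟫| ^ 2 ≤ ‖x‖ ^ 2 := by
    simp only [sq_abs]
    exact sum_le_hasSum _ (fun i _ => sq_nonneg _) (b.hasSum_inner_sq x)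
  calc ‖∑ i ∈ t \ s, ⟪b i, x⟫ • A (b i)‖ ^ 2
      ≤ (∑ i ∈ t \ s, |⟪b i, x⟫| * ‖A (b i)‖) ^ 2 := by
        gcongr
        refine (norm_sum_le _ _).trans_eq (Finset.sum_congr rfl fun i _ => ?_)
        rw [norm_smul, Real.norm_eq_abs]
    _ ≤ (∑ i ∈ t \ s, |⟪b i, x⟫| ^ 2) * ∑ i ∈ t \ s, ‖A (b i)‖ ^ 2 :=
        Finset.sum_mul_sq_le_sq_mul_sq _ _ _
    _ ≤ ‖x‖ ^ 2 * (ε / 2) ^ 2 := by gcongr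
    _ = (ε / 2 * ‖x‖) ^ 2 := by ring

/-- A compact symmetric operator has a Hilbert basis of eigenvectors. -/
theorem exists_hilbertBasis_eigenvectors [CompleteSpace H] {A : H →L[ℝ] H}
    (hA : IsCompactOperator A) (hs : (A : H →ₗ[ℝ] H).IsSymmetric) :
    ∃ (s : Set H) (b : HilbertBasis s ℝ H), ∀ i, A (b i) = ⟪A (b i), b i⟫ • b i := by
  have hc : ∀ t : ℝ, CompleteSpace (Module.End.eigenspace (A : H →ₗ[ℝ] H) t) := fun t => by
    have : IsClosed ((Module.End.eigenspace (A : H →ₗ[ℝ] H) t : Submodule ℝ H) : Set H) := by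
      have h : ((Module.End.eigenspace (A : H →ₗ[ℝ] H) t : Submodule ℝ H) : Set H) =
          {x | A x = t • x} := by
        ext x; simp
      rw [h]
      exact isClosed_eq A.continuous (continuous_const_smul t)
    exact this.completeSpace_coe
  choose w e he using fun t : ℝ =>
    exists_hilbertBasis ℝ (Module.End.eigenspace (A : H →ₗ[ℝ] H) t)
  have ho := hs.orthogonalFamily_eigenspaces.orthonormal_sigma_orthonormal
    (v_family := fun t => e t) (fun t => (e t).orthonormal)
  set f : (Σ t, w t) → H := fun a => ((e a.1 a.2 : Module.End.eigenspace (A : H →ₗ[ℝ] H) a.1) : H)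
    with hf
  have ho' : Orthonormal ℝ (Subtype.val : Set.range f → H) := ho.toSubtypeRange
  -- If `x` is orthogonal to every chosen eigenvector, its projection onto each eigenspace has zero
  -- coefficients, so `x` is orthogonal to all eigenspaces; the compact spectral theorem then gives
  -- `x = 0`.
  have hsp : (Submodule.span ℝ (Set.range (Subtype.val : Set.range f → H)))ᗮ = ⊥ := by
    rw [Subtype.range_coe, eq_bot_iff,
      ← ContinuousLinearMap.orthogonalComplement_iSup_eigenspaces_eq_bot hA hs]
    rw [← Submodule.iInf_orthogonal]
    intro x hx
    rw [Submodule.mem_iInf]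
    intro t
    rw [Submodule.mem_orthogonal]
    intro v hv
    have h1 := ((e t).hasSum_inner_mul_inner ⟨v, hv⟩
      ((Module.End.eigenspace (A : H →ₗ[ℝ] H) t).orthogonalProjectionOnto x))
    have h2 : ∀ i, ⟪e t i, (Module.End.eigenspace (A : H →ₗ[ℝ] H) t).orthogonalProjectionOnto x⟫
        = 0 := by
      intro i
      rw [Submodule.inner_orthogonalProjectionOnto_eq_of_mem_left]
      exact (Submodule.mem_orthogonal _ _).1 hx _ (Submodule.subset_span ⟨⟨t, i⟩, rfl⟩)
    simp only [h2, mul_zero] at h1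
    have h3 := h1.unique hasSum_zero
    rwa [Submodule.inner_orthogonalProjectionOnto_eq_of_mem_left] at h3
  refine ⟨Set.range f, HilbertBasis.mkOfOrthogonalEqBot ho' hsp, ?_⟩
  rintro ⟨_, ⟨⟨t, i⟩, rfl⟩⟩
  rw [HilbertBasis.coe_mkOfOrthogonalEqBot]
  have h1 : A (f ⟨t, i⟩) = t • f ⟨t, i⟩ := Module.End.mem_eigenspace_iff.1 (e t i).2
  have h2 : ‖f ⟨t, i⟩‖ = 1 := ho.1 ⟨t, i⟩
  simp only [h1, real_inner_smul_left, real_inner_self_eq_norm_sq, h2]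
  simp

theorem IsPosTraceClass.exists_eigenbasis [CompleteSpace H] {A : H →L[ℝ] H}
    (hA : IsPosTraceClass A) :
    ∃ (s : Set H) (b : HilbertBasis s ℝ H), ∀ i, A (b i) = ⟪A (b i), b i⟫ • b i := by
  obtain ⟨s, b, -⟩ := exists_hilbertBasis ℝ H
  refine exists_hilbertBasis_eigenvectors (isCompactOperator_of_summable_norm_sq b A ?_)
    hA.1.isSymmetric
  exact ((hA.2 s b).mul_left ‖A‖).of_nonneg_of_le (fun i => sq_nonneg _)
    fun i => hA.1.norm_apply_sq_le _

/-! ### The determinant as a product along an eigenbasis -/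

section Determinant

variable {ι : Type*} {A : H →L[ℝ] H} {l : ι → ℝ}

theorem inner_eigenbasis_apply (hA : A.IsPositive) (b : HilbertBasis ι ℝ H)
    (hb : ∀ i, A (b i) = l i • b i) (i : ι) (x : H) : ⟪b i, A x⟫ = l i * ⟪b i, x⟫ := by
  rw [← hA.inner_symm, hb, real_inner_smul_left]

theorem eigenspace_eq_span (hA : A.IsPositive) (b : HilbertBasis ι ℝ H)
    (hb : ∀ i, A (b i) = l i • b i) {t : ℝ} (ht : Finite {i // l i = t}) :
    Module.End.eigenspace (A : H →ₗ[ℝ] H) t =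
      Submodule.span ℝ (Set.range fun i : {i // l i = t} => b i) := by
  apply le_antisymm
  · intro x hx
    have hx' : A x = t • x := Module.End.mem_eigenspace_iff.1 hx
    have h0 : ∀ i, l i ≠ t → ⟪b i, x⟫ = 0 := by
      intro i hi
      have h := inner_eigenbasis_apply hA b hb i x
      rw [hx', real_inner_smul_right] at h
      have : (l i - t) * ⟪b i, x⟫ = 0 := by linarith
      exact (mul_eq_zero.1 this).resolve_left (sub_ne_zero.2 hi)
    have hfin : {i | l i = t}.Finite := ht
    have h1 : x = ∑ i ∈ hfin.toFinset, ⟪b i, x⟫ • b i := by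
      have h := b.hasSum_repr x
      simp only [HilbertBasis.repr_apply_apply] at h
      refine h.unique (hasSum_sum_of_ne_finset_zero fun i hi => ?_)
      rw [h0 i (by simpa using hi), zero_smul]
    rw [h1]
    refine Submodule.sum_mem _ fun i hi => Submodule.smul_mem _ _ (Submodule.subset_span ?_)
    exact ⟨⟨i, by simpa using hi⟩, rfl⟩
  · rw [Submodule.span_le]
    rintro _ ⟨⟨i, rfl⟩, rfl⟩
    exact Module.End.mem_eigenspace_iff.2 (hb i)

theorem eigenMult_eq_card (hA : A.IsPositive) (b : HilbertBasis ι ℝ H)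
    (hb : ∀ i, A (b i) = l i • b i) {t : ℝ} [Fintype {i // l i = t}] :
    eigenMult A t = Fintype.card {i // l i = t} := by
  rw [eigenMult, eigenspace_eq_span hA b hb (Finite.of_fintype _)]
  exact finrank_span_eq_card (b.orthonormal.linearIndependent.comp _ Subtype.val_injective)

theorem Summable.finite_fiber (hl : Summable l) {t : ℝ} (ht : t ≠ 0) : Finite {i // l i = t} := by
  have h := hl.tendsto_cofinite_zero.eventually (isOpen_ne.mem_nhds ht.symm : {t}ᶜ ∈ 𝓝 (0 : ℝ))
  rw [eventually_cofinite] at h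
  have he : {i | l i = t} = {i | ¬ l i ∈ ({t}ᶜ : Set ℝ)} := by ext i; simp
  exact (he ▸ h : {i | l i = t}.Finite)

/-- The Fredholm determinant in terms of an orthonormal basis of eigenvectors. -/
theorem hasProd_one_add_eigenMult (hA : A.IsPositive) (b : HilbertBasis ι ℝ H)
    (hb : ∀ i, A (b i) = l i • b i) (h0 : ∀ i, 0 ≤ l i) (hl : Summable l) :
    HasProd (fun t : ℝ => (1 + t) ^ eigenMult A t) (Real.exp (∑' i, Real.log (1 + l i))) := by
  have h1 : HasProd (fun i => 1 + l i) (Real.exp (∑' i, Real.log (1 + l i))) :=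
    Real.hasProd_of_hasSum_log (fun i => by linarith [h0 i])
      (Real.summable_log_one_add_of_summable hl).hasSum
  -- Regroup the product by the value of the eigenvalue: the fibre over `t` contributes `1 + t` once
  -- per basis vector.
  rw [← (Equiv.sigmaFiberEquiv l).hasProd_iff] at h1
  refine h1.sigma fun t => ?_
  have he : (fun c : {i // l i = t} =>
      ((fun i => 1 + l i) ∘ Equiv.sigmaFiberEquiv l) ⟨t, c⟩) = fun _ => 1 + t := by
    funext c
    simp [Equiv.sigmaFiberEquiv, c.2]
  rw [he]
  -- The kernel may be infinite-dimensional, but its factors are all `1`, whatever the value of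
  -- `eigenMult A 0`.
  by_cases ht : t = 0
  · subst ht
    simp [hasProd_one]
  · have := hl.finite_fiber ht
    have := Fintype.ofFinite {i // l i = t}
    rw [eigenMult_eq_card hA b hb]
    simpa using hasProd_fintype (fun _ : {i // l i = t} => 1 + t)

theorem detOneAdd_eq_exp (hA : A.IsPositive) (b : HilbertBasis ι ℝ H)
    (hb : ∀ i, A (b i) = l i • b i) (h0 : ∀ i, 0 ≤ l i) (hl : Summable l) :
    detOneAdd A = Real.exp (∑' i, Real.log (1 + l i)) :=
  (hasProd_one_add_eigenMult hA b hb h0 hl).tprod_eq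

theorem detOneAdd_rpow_eq_exp (hA : A.IsPositive) (b : HilbertBasis ι ℝ H)
    (hb : ∀ i, A (b i) = l i • b i) (h0 : ∀ i, 0 ≤ l i) (hl : Summable l) :
    detOneAdd A ^ (-(1 / 2) : ℝ) = Real.exp (-(1 / 2) * ∑' i, Real.log (1 + l i)) := by
  rw [detOneAdd_eq_exp hA b hb h0 hl, ← Real.exp_mul, mul_comm]

end Determinant

theorem IsPosTraceClass.finiteDimensional_eigenspace [CompleteSpace H] {A : H →L[ℝ] H}
    (hA : IsPosTraceClass A) {t : ℝ} (ht : t ≠ 0) :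
    FiniteDimensional ℝ (Module.End.eigenspace (A : H →ₗ[ℝ] H) t) := by
  obtain ⟨s, b, hb⟩ := hA.exists_eigenbasis
  have hf := (hA.2 s b).finite_fiber ht
  rw [eigenspace_eq_span hA.1 b hb hf]
  exact FiniteDimensional.span_of_finite ℝ (Set.finite_range _)

theorem IsPosTraceClass.multipliable [CompleteSpace H] {A : H →L[ℝ] H}
    (hA : IsPosTraceClass A) : Multipliable fun t : ℝ => (1 + t) ^ eigenMult A t := by
  obtain ⟨s, b, hb⟩ := hA.exists_eigenbasis
  exact (hasProd_one_add_eigenMult hA.1 b hb (fun i => hA.1.inner_nonneg_left _)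
    (hA.2 s b)).multipliable

theorem IsPosTraceClass.add [CompleteSpace H] {A B : H →L[ℝ] H} (hA : IsPosTraceClass A)
    (hB : IsPosTraceClass B) : IsPosTraceClass (A + B) :=
  ⟨hA.1.add hB.1, fun s b => by simpa [inner_add_left] using (hA.2 s b).add (hB.2 s b)⟩

theorem IsPosTraceClass.smul [CompleteSpace H] {A : H →L[ℝ] H} (hA : IsPosTraceClass A) {c : ℝ}
    (hc : 0 ≤ c) : IsPosTraceClass (c • A) :=
  ⟨hA.1.smul_of_nonneg hc, fun s b => by
    simpa [real_inner_smul_left] using (hA.2 s b).mul_left c⟩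

end Spectral

/-! ### Hadamard's inequality and strict convexity -/

section StrictConvexity

open Filter Topology

variable {H : Type*} [NormedAddCommGroup H] [InnerProductSpace ℝ H]

theorem Real.log_one_add_le_tangent {a c : ℝ} (ha : 0 ≤ a) (hc : 0 ≤ c) :
    Real.log (1 + a) ≤ Real.log (1 + c) + (a - c) / (1 + c) := by
  have h := Real.log_le_sub_one_of_pos (show 0 < (1 + a) / (1 + c) by positivity)
  rw [Real.log_div (by positivity) (by positivity)] at h
  have : (1 + a) / (1 + c) - 1 = (a - c) / (1 + c) := by field_simp; ring
  linarith

theorem Real.eq_of_log_one_add_eq_tangent {a c : ℝ} (ha : 0 ≤ a) (hc : 0 ≤ c)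
    (h : Real.log (1 + a) = Real.log (1 + c) + (a - c) / (1 + c)) : a = c := by
  by_contra hne
  have h1 := Real.log_lt_sub_one_of_pos (show 0 < (1 + a) / (1 + c) by positivity) (by
    rw [ne_eq, div_eq_one_iff_eq (by positivity)]
    exact fun h => hne (by linarith))
  rw [Real.log_div (by positivity) (by positivity)] at h1
  have : (1 + a) / (1 + c) - 1 = (a - c) / (1 + c) := by field_simp; ring
  linarith

section Hadamard

variable {ι κ : Type*} {A : H →L[ℝ] H} {a : κ → ℝ}

theorem hasSum_inner_sq_mul_eigenvalue (hA : A.IsPositive) (f : HilbertBasis κ ℝ H)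
    (hf : ∀ j, A (f j) = a j • f j) (x : H) :
    HasSum (fun j => ⟪f j, x⟫ ^ 2 * a j) ⟪A x, x⟫ := by
  refine (f.hasSum_inner_mul_inner (A x) x).congr_fun fun j => ?_
  rw [real_inner_comm (f j) (A x), inner_eigenbasis_apply hA f hf]
  ring

variable (e : HilbertBasis ι ℝ H) (f : HilbertBasis κ ℝ H)

/-- The weights `⟪f j, x⟫²` form a probability vector under which `a` has mean `⟪A x, x⟫`, so the
linear part of the tangent to `log (1 + ·)` at the mean sums to zero. The Jensen gap thus becomes a
sum of nonnegative terms, which also settles the equality case. -/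
theorem hasSum_tangent_gap (hA : A.IsPositive) (hf : ∀ j, A (f j) = a j • f j)
    {x : H} (hx : ‖x‖ = 1) (hs : Summable fun j => ⟪f j, x⟫ ^ 2 * Real.log (1 + a j)) :
    HasSum (fun j => ⟪f j, x⟫ ^ 2 * (Real.log (1 + ⟪A x, x⟫) +
        (a j - ⟪A x, x⟫) / (1 + ⟪A x, x⟫) - Real.log (1 + a j)))
      (Real.log (1 + ⟪A x, x⟫) - ∑' j, ⟪f j, x⟫ ^ 2 * Real.log (1 + a j)) := by
  have h1 := f.hasSum_inner_sq x
  rw [hx, one_pow] at h1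
  have h2 := hasSum_inner_sq_mul_eigenvalue hA f hf x
  set α := ⟪A x, x⟫
  have h3 := ((h1.mul_right (Real.log (1 + α))).add
    ((h2.sub (h1.mul_right α)).div_const (1 + α))).sub hs.hasSum
  rw [one_mul, one_mul, sub_self, zero_div, add_zero] at h3
  refine h3.congr_fun fun j => ?_
  ring

theorem summable_inner_sq_mul_log (h0 : ∀ j, 0 ≤ a j) (ha : Summable a) {x : H} (hx : ‖x‖ = 1) :
    Summable fun j => ⟪f j, x⟫ ^ 2 * Real.log (1 + a j) := by
  refine (Real.summable_log_one_add_of_summable ha).of_nonneg_of_le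
    (fun j => mul_nonneg (sq_nonneg _) (Real.log_nonneg (by linarith [h0 j]))) fun j => ?_
  refine mul_le_of_le_one_left (Real.log_nonneg (by linarith [h0 j])) ?_
  rw [← sq_abs]
  refine pow_le_one₀ (abs_nonneg _) ((abs_real_inner_le_norm _ _).trans ?_)
  rw [hx, f.orthonormal.1 j, one_mul]

/-- Jensen's inequality for the spectral measure of `A` at a unit vector. -/
theorem tsum_inner_sq_mul_log_le (hA : A.IsPositive) (hf : ∀ j, A (f j) = a j • f j)
    (h0 : ∀ j, 0 ≤ a j) (ha : Summable a) {x : H} (hx : ‖x‖ = 1) :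
    ∑' j, ⟪f j, x⟫ ^ 2 * Real.log (1 + a j) ≤ Real.log (1 + ⟪A x, x⟫) := by
  have h := hasSum_tangent_gap f hA hf hx (summable_inner_sq_mul_log f h0 ha hx)
  refine sub_nonneg.1 (h.nonneg fun j => mul_nonneg (sq_nonneg _) ?_)
  exact sub_nonneg.2 (Real.log_one_add_le_tangent (h0 j) (hA.inner_nonneg_left x))

theorem tsum_inner_sq_mul_log_lt (hA : A.IsPositive) (hf : ∀ j, A (f j) = a j • f j)
    (h0 : ∀ j, 0 ≤ a j) (ha : Summable a) {x : H} (hx : ‖x‖ = 1) (hne : A x ≠ ⟪A x, x⟫ • x) :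
    ∑' j, ⟪f j, x⟫ ^ 2 * Real.log (1 + a j) < Real.log (1 + ⟪A x, x⟫) := by
  refine (tsum_inner_sq_mul_log_le f hA hf h0 ha hx).lt_of_ne fun heq => hne ?_
  have h := hasSum_tangent_gap f hA hf hx (summable_inner_sq_mul_log f h0 ha hx)
  rw [heq, sub_self, hasSum_zero_iff_of_nonneg (fun j => mul_nonneg (sq_nonneg _)
    (sub_nonneg.2 (Real.log_one_add_le_tangent (h0 j) (hA.inner_nonneg_left x))))] at h
  refine f.eq_of_inner_eq fun j => ?_
  rw [inner_eigenbasis_apply hA f hf, real_inner_smul_right]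
  -- A vanishing gap means that each `j` has zero weight or has `a j` equal to the mean; either way
  -- the coefficients of `A x` and `⟪A x, x⟫ • x` agree.
  rcases mul_eq_zero.1 (congrFun h j) with h1 | h1
  · rw [pow_eq_zero_iff two_ne_zero] at h1
    rw [h1, mul_zero, mul_zero]
  · rw [Real.eq_of_log_one_add_eq_tangent (h0 j) (hA.inner_nonneg_left x) (sub_eq_zero.1 h1).symm]

/-- Basis independence of the trace of `log (I + A)`: the terms are nonnegative, so the double sum
may be exchanged, and Parseval collapses the sum over `e`. -/
theorem hasSum_tsum_inner_sq_mul_log (h0 : ∀ j, 0 ≤ a j) (ha : Summable a) :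
    HasSum (fun i => ∑' j, ⟪f j, e i⟫ ^ 2 * Real.log (1 + a j)) (∑' j, Real.log (1 + a j)) := by
  have hnn : 0 ≤ fun p : κ × ι => ⟪f p.1, e p.2⟫ ^ 2 * Real.log (1 + a p.1) := fun p =>
    mul_nonneg (sq_nonneg _) (Real.log_nonneg (by linarith [h0 p.1]))
  have hcol : ∀ j, HasSum (fun i => ⟪f j, e i⟫ ^ 2 * Real.log (1 + a j)) (Real.log (1 + a j)) := by
    intro j
    have h := (e.hasSum_inner_sq (f j)).mul_right (Real.log (1 + a j))
    rw [f.orthonormal.1 j, one_pow, one_mul] at h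
    refine h.congr_fun fun i => ?_
    rw [real_inner_comm]
  have hs : Summable fun p : κ × ι => ⟪f p.1, e p.2⟫ ^ 2 * Real.log (1 + a p.1) := by
    rw [summable_prod_of_nonneg hnn]
    refine ⟨fun j => (hcol j).summable, ?_⟩
    simpa only [(hcol _).tsum_eq] using Real.summable_log_one_add_of_summable ha
  have hs' := (Equiv.prodComm ι κ).summable_iff.2 hs
  have h1 : ∑' i, ∑' j, ⟪f j, e i⟫ ^ 2 * Real.log (1 + a j) = ∑' j, Real.log (1 + a j) := by
    rw [Summable.tsum_comm (f := fun j i => ⟪f j, e i⟫ ^ 2 * Real.log (1 + a j)) hs]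
    exact tsum_congr fun j => (hcol j).tsum_eq
  rw [← h1]
  exact hs'.prod.hasSum

/-- Hadamard's inequality for the Fredholm determinant. -/
theorem tsum_log_eigenvalue_le (hA : A.IsPositive) (hf : ∀ j, A (f j) = a j • f j)
    (h0 : ∀ j, 0 ≤ a j) (ha : Summable a) (hd : Summable fun i => ⟪A (e i), e i⟫) :
    ∑' j, Real.log (1 + a j) ≤ ∑' i, Real.log (1 + ⟪A (e i), e i⟫) := by
  have h := hasSum_tsum_inner_sq_mul_log e f h0 ha
  rw [← h.tsum_eq]
  exact h.summable.tsum_le_tsum (fun i => tsum_inner_sq_mul_log_le f hA hf h0 ha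
    (e.orthonormal.1 i)) (Real.summable_log_one_add_of_summable hd)

theorem tsum_log_eigenvalue_lt (hA : A.IsPositive) (hf : ∀ j, A (f j) = a j • f j)
    (h0 : ∀ j, 0 ≤ a j) (ha : Summable a) (hd : Summable fun i => ⟪A (e i), e i⟫)
    {i : ι} (hi : A (e i) ≠ ⟪A (e i), e i⟫ • e i) :
    ∑' j, Real.log (1 + a j) < ∑' i, Real.log (1 + ⟪A (e i), e i⟫) := by
  have h := hasSum_tsum_inner_sq_mul_log e f h0 ha
  rw [← h.tsum_eq]
  exact Summable.tsum_lt_tsum (i := i) (fun i => tsum_inner_sq_mul_log_le f hA hf h0 ha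
    (e.orthonormal.1 i)) (tsum_inner_sq_mul_log_lt f hA hf h0 ha (e.orthonormal.1 i) hi)
    h.summable (Real.summable_log_one_add_of_summable hd)

end Hadamard

/-- The commuting case of strict convexity. Strictness comes from strict concavity of `log` at one
index where `α` and `β` differ; for `exp` plain convexity suffices. -/
theorem exp_tsum_log_one_add_convex {ι : Type*} {α β : ι → ℝ} (hα : ∀ i, 0 ≤ α i)
    (hβ : ∀ i, 0 ≤ β i) (sα : Summable α) (sβ : Summable β) {p q : ℝ} (hp : 0 < p) (hq : 0 < q)
    (hpq : p + q = 1) :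
    Real.exp (-(1 / 2) * ∑' i, Real.log (1 + (p * α i + q * β i))) ≤
      p * Real.exp (-(1 / 2) * ∑' i, Real.log (1 + α i)) +
        q * Real.exp (-(1 / 2) * ∑' i, Real.log (1 + β i)) ∧
    (α ≠ β → Real.exp (-(1 / 2) * ∑' i, Real.log (1 + (p * α i + q * β i))) <
      p * Real.exp (-(1 / 2) * ∑' i, Real.log (1 + α i)) +
        q * Real.exp (-(1 / 2) * ∑' i, Real.log (1 + β i))) := by
  have lα := Real.summable_log_one_add_of_summable sα
  have lβ := Real.summable_log_one_add_of_summable sβ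
  have lm := Real.summable_log_one_add_of_summable ((sα.mul_left p).add (sβ.mul_left q))
  have lpq := (lα.mul_left p).add (lβ.mul_left q)
  have hsum : ∑' i, (p * Real.log (1 + α i) + q * Real.log (1 + β i)) =
      p * ∑' i, Real.log (1 + α i) + q * ∑' i, Real.log (1 + β i) := by
    rw [(lα.mul_left p).tsum_add (lβ.mul_left q), tsum_mul_left, tsum_mul_left]
  have he : ∀ i, p • (1 + α i) + q • (1 + β i) = 1 + (p * α i + q * β i) := fun i => by
    simp only [smul_eq_mul]; linear_combination hpq
  have hle : ∀ i, p * Real.log (1 + α i) + q * Real.log (1 + β i) ≤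
      Real.log (1 + (p * α i + q * β i)) := fun i => by
    rw [← he]
    exact strictConcaveOn_log_Ioi.concaveOn.2 (by simp; linarith [hα i]) (by simp; linarith [hβ i])
      hp.le hq.le hpq
  have hexp : Real.exp (-(1 / 2) * (p * ∑' i, Real.log (1 + α i) + q * ∑' i, Real.log (1 + β i))) ≤
      p * Real.exp (-(1 / 2) * ∑' i, Real.log (1 + α i)) +
        q * Real.exp (-(1 / 2) * ∑' i, Real.log (1 + β i)) := by
    have := convexOn_exp.2 (Set.mem_univ (-(1 / 2) * ∑' i, Real.log (1 + α i)))
      (Set.mem_univ (-(1 / 2) * ∑' i, Real.log (1 + β i))) hp.le hq.le hpq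
    simp only [smul_eq_mul] at this
    refine le_of_eq_of_le ?_ this
    congr 1
    ring
  constructor
  · refine le_trans (Real.exp_le_exp.2 ?_) hexp
    have := lpq.tsum_le_tsum hle lm
    rw [hsum] at this
    linarith
  · intro hne
    obtain ⟨i, hi⟩ := Function.ne_iff.1 hne
    refine lt_of_lt_of_le (Real.exp_lt_exp.2 ?_) hexp
    have hlt : p * Real.log (1 + α i) + q * Real.log (1 + β i) <
        Real.log (1 + (p * α i + q * β i)) := by
      rw [← he]
      exact strictConcaveOn_log_Ioi.2 (by simp; linarith [hα i]) (by simp; linarith [hβ i])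
        (by simpa using hi) hp hq hpq
    have := Summable.tsum_lt_tsum hle hlt lpq lm
    rw [hsum] at this
    linarith

/-- `A ↦ |I + A|^{-1/2}` is strictly convex on the positive trace-class operators. -/
theorem strictConvexOn_detOneAdd_rpow [CompleteSpace H] :
    StrictConvexOn ℝ {A : H →L[ℝ] H | IsPosTraceClass A}
      (fun A => detOneAdd A ^ (-(1 / 2) : ℝ)) := by
  refine ⟨fun A hA B hB p q hp hq _ => (hA.smul hp).add (hB.smul hq), ?_⟩
  intro A hA B hB hAB p q hp hq hpq
  have hM : IsPosTraceClass (p • A + q • B) := (hA.smul hp.le).add (hB.smul hq.le)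
  obtain ⟨s, e, he⟩ := hM.exists_eigenbasis
  obtain ⟨sA, f, hf⟩ := hA.exists_eigenbasis
  obtain ⟨sB, g, hg⟩ := hB.exists_eigenbasis
  simp only [smul_eq_mul]
  rw [detOneAdd_rpow_eq_exp hM.1 e he (fun i => hM.1.inner_nonneg_left _) (hM.2 s e),
    detOneAdd_rpow_eq_exp hA.1 f hf (fun i => hA.1.inner_nonneg_left _) (hA.2 sA f),
    detOneAdd_rpow_eq_exp hB.1 g hg (fun i => hB.1.inner_nonneg_left _) (hB.2 sB g)]
  have hmid : ∀ i, ⟪(p • A + q • B) (e i), e i⟫ = p * ⟪A (e i), e i⟫ + q * ⟪B (e i), e i⟫ := by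
    intro i
    simp [inner_add_left, real_inner_smul_left]
  simp only [hmid] at he ⊢
  obtain ⟨h1, h2⟩ := exp_tsum_log_one_add_convex (fun i => hA.1.inner_nonneg_left (e i))
    (fun i => hB.1.inner_nonneg_left (e i)) (hA.2 s e) (hB.2 s e) hp hq hpq
  have hAle := tsum_log_eigenvalue_le e f hA.1 hf (fun i => hA.1.inner_nonneg_left _)
    (hA.2 sA f) (hA.2 s e)
  have hBle := tsum_log_eigenvalue_le e g hB.1 hg (fun i => hB.1.inner_nonneg_left _)
    (hB.2 sB g) (hB.2 s e)
  have hAexp := mul_le_mul_of_nonneg_left (Real.exp_le_exp.2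
    (mul_le_mul_of_nonpos_left hAle (by norm_num : -(1 / 2 : ℝ) ≤ 0))) hp.le
  have hBexp := mul_le_mul_of_nonneg_left (Real.exp_le_exp.2
    (mul_le_mul_of_nonpos_left hBle (by norm_num : -(1 / 2 : ℝ) ≤ 0))) hq.le
  -- If the diagonals differ, the commuting case is strict. If they agree, either Hadamard is strict
  -- for `A`, or `A` is diagonal in `e`; then so is `B`, with the same diagonal, contradicting `A ≠
  -- B`.
  by_cases hd : (fun i => ⟪A (e i), e i⟫) = fun i => ⟪B (e i), e i⟫
  · by_cases hAd : ∀ i, A (e i) = ⟪A (e i), e i⟫ • e i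
    · refine absurd ?_ hAB
      have hBd : ∀ i, B (e i) = ⟪A (e i), e i⟫ • e i := fun i => by
        have h := he i
        rw [← congrFun hd i, ← add_mul, hpq, one_mul] at h
        simp only [add_apply, smul_apply] at h
        rw [hAd i, real_inner_smul_left, real_inner_self_eq_norm_sq, e.orthonormal.1 i] at h
        rw [hAd i, real_inner_smul_left, real_inner_self_eq_norm_sq, e.orthonormal.1 i]
        have h3 : q • B (e i) = q • (⟪A (e i), e i⟫ * 1 ^ 2) • e i := by
          rw [← sub_eq_zero, ← sub_eq_zero.2 h, smul_smul, smul_smul, show p = 1 - q by linarith]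
          module
        exact smul_right_injective H hq.ne' h3
      ext x
      refine e.eq_of_inner_eq fun i => ?_
      rw [inner_eigenbasis_apply hA.1 e hAd, inner_eigenbasis_apply hB.1 e hBd]
    · push Not at hAd
      obtain ⟨i, hi⟩ := hAd
      have hlt := tsum_log_eigenvalue_lt e f hA.1 hf (fun i => hA.1.inner_nonneg_left _)
        (hA.2 sA f) (hA.2 s e) hi
      have hlt' := mul_lt_mul_of_pos_left (Real.exp_lt_exp.2
        (mul_lt_mul_of_neg_left hlt (by norm_num : -(1 / 2 : ℝ) < 0))) hp
      linarith
  · have := h2 hd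
    linarith

end StrictConvexity

/-! ### Integrals of the Gaussian kernel against Gaussian measures -/

section GaussianIntegral

open Filter Topology

theorem integral_exp_neg_mul_sq_gaussianReal {σ : ℝ} (hσ : 0 < σ) (x m : ℝ) {v : ℝ} (hv : 0 ≤ v) :
    ∫ y, Real.exp (-σ * (x - y) ^ 2) ∂(gaussianReal m v.toNNReal) =
      Real.exp (-(1 / 2) * Real.log (1 + 2 * σ * v) - σ * ((x - m) ^ 2 / (1 + 2 * σ * v))) := by
  rcases hv.eq_or_lt with rfl | hv
  · simp [gaussianReal_zero_var]
  have hv' : v.toNNReal ≠ 0 := by simpa using hv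
  rw [integral_gaussianReal_eq_integral_smul hv']
  set w := 1 + 2 * σ * v with hw
  have hw0 : 0 < w := by positivity
  -- Completing the square in `y`: density times kernel is a multiple of a Gaussian with variance `v
  -- / w`.
  have hD : ∀ y, gaussianPDFReal m v.toNNReal y • Real.exp (-σ * (x - y) ^ 2) =
      ((√(2 * Real.pi * v))⁻¹ * Real.exp (-σ * ((x - m) ^ 2 / w))) *
        Real.exp (-(w / (2 * v)) * (y - (m + 2 * σ * v * x) / w) ^ 2) := by
    intro y
    rw [gaussianPDFReal, Real.coe_toNNReal _ hv.le, smul_eq_mul, mul_assoc (√_)⁻¹,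
      mul_assoc (√_)⁻¹, ← Real.exp_add, ← Real.exp_add]
    congr 2
    field_simp
    rw [hw]
    ring
  simp_rw [hD]
  rw [integral_const_mul, integral_sub_right_eq_self
    (fun y => Real.exp (-(w / (2 * v)) * y ^ 2)), integral_gaussian]
  have h1 : Real.exp (-(1 / 2) * Real.log w) = (√w)⁻¹ := by
    rw [Real.sqrt_eq_rpow, ← Real.rpow_neg hw0.le, Real.rpow_def_of_pos hw0, mul_comm]
  have h2 : √(Real.pi / (w / (2 * v))) = √(2 * Real.pi * v) * (√w)⁻¹ := by
    rw [← Real.sqrt_inv, ← Real.sqrt_mul (by positivity)]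
    congr 1
    field_simp
  have h3 : √(2 * Real.pi * v) ≠ 0 := by positivity
  rw [sub_eq_add_neg (-(1 / 2) * Real.log w), Real.exp_add, h1, h2, ← neg_mul]
  field_simp

variable {H : Type*} [NormedAddCommGroup H] [InnerProductSpace ℝ H] [CompleteSpace H]

/-- Coercivity: `⟪(1 + c C) x, x⟫ ≥ ‖x‖²`. -/
theorem ContinuousLinearMap.IsPositive.isUnit_one_add_smul {C : H →L[ℝ] H} (hC : C.IsPositive)
    {c : ℝ} (hc : 0 ≤ c) : IsUnit (1 + c • C) := by
  refine ContinuousLinearMap.isUnit_of_forall_le_norm_inner_map _ one_pos fun x => ?_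
  have h := mul_nonneg hc (hC.inner_nonneg_left x)
  refine le_trans ?_ (Real.le_norm_self _)
  simp only [add_apply, one_apply_eq_self, smul_apply, inner_add_left, real_inner_smul_left,
    real_inner_self_eq_norm_sq, NNReal.coe_one]
  linarith

theorem inner_inverse_one_add_smul {C : H →L[ℝ] H} (hC : C.IsPositive) {c : ℝ} (hc : 0 ≤ c)
    (v : H) : ‖Ring.inverse (1 + c • C) v‖ ^ 2 ≤ ⟪Ring.inverse (1 + c • C) v, v⟫ ∧
      (1 + c • C) (Ring.inverse (1 + c • C) v) = v := by
  have h := congrArg (fun T : H →L[ℝ] H => T v)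
    (Ring.mul_inverse_cancel _ (hC.isUnit_one_add_smul hc))
  have h' : (1 + c • C) (Ring.inverse (1 + c • C) v) = v := h
  refine ⟨?_, h'⟩
  set u := Ring.inverse (1 + c • C) v
  have h2 := mul_nonneg hc (hC.inner_nonneg_right u)
  rw [← h']
  simp only [add_apply, one_apply_eq_self, smul_apply, inner_add_right, real_inner_smul_right,
    real_inner_self_eq_norm_sq]
  linarith

theorem hasSum_inner_inverse_one_add_smul {ι : Type*} {C : H →L[ℝ] H} {l : ι → ℝ}
    (hC : C.IsPositive) (b : HilbertBasis ι ℝ H) (hb : ∀ i, C (b i) = l i • b i)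
    (h0 : ∀ i, 0 ≤ l i) {c : ℝ} (hc : 0 ≤ c) (v : H) :
    HasSum (fun i => ⟪b i, v⟫ ^ 2 / (1 + c * l i)) ⟪Ring.inverse (1 + c • C) v, v⟫ := by
  have hu := hC.isUnit_one_add_smul hc
  set u := Ring.inverse (1 + c • C) v with hu'
  have huv : u + c • C u = v := by
    have h := congrArg (fun T : H →L[ℝ] H => T v) (Ring.mul_inverse_cancel _ hu)
    simpa using! h
  refine (b.hasSum_inner_mul_inner u v).congr_fun fun i => ?_
  have h1 : ⟪b i, v⟫ = (1 + c * l i) * ⟪b i, u⟫ := by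
    rw [← huv, inner_add_right, real_inner_smul_right, inner_eigenbasis_apply hC b hb]
    ring
  have h2 : 1 + c * l i ≠ 0 := by have := mul_nonneg hc (h0 i); positivity
  rw [real_inner_comm (b i) u, h1]
  field_simp

/-- Distinct vectors are at distance `√2`, so balls of radius `1 / 2` are disjoint. Countability of
the eigenbasis is what lets dominated convergence run along its finite subsets. -/
theorem Orthonormal.countable {E ι : Type*} [NormedAddCommGroup E] [InnerProductSpace ℝ E]
    [TopologicalSpace.SeparableSpace E] {v : ι → E} (hv : Orthonormal ℝ v) : Countable ι := by
  rw [← Set.countable_univ_iff]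
  refine Set.PairwiseDisjoint.countable_of_isOpen (s := fun i => Metric.ball (v i) (1 / 2))
    (fun i _ j _ hij => Metric.ball_disjoint_ball ?_) (fun i _ => Metric.isOpen_ball)
    fun i _ => Metric.nonempty_ball.2 (by norm_num)
  have h : ‖v i - v j‖ ^ 2 = 2 := by
    rw [norm_sub_sq_real, hv.1, hv.1, hv.2 hij]
    norm_num
  rw [dist_eq_norm]
  nlinarith [norm_nonneg (v i - v j)]

namespace IsGaussianWith

variable [MeasurableSpace H] {P : Measure H} {μ : H} {C : H →L[ℝ] H}

theorem isGaussian [BorelSpace H] (hP : IsGaussianWith P μ C) : IsGaussian P := by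
  refine isGaussian_of_map_eq_gaussianReal fun L => ?_
  refine ⟨_, _, (?_ : P.map L = _).trans (hP.2 ((InnerProductSpace.toDual ℝ H).symm L))⟩
  simp

theorem hasGaussianLaw_inner (hP : IsGaussianWith P μ C) (a : H) :
    HasGaussianLaw (fun y => ⟪a, y⟫) P := ⟨by rw [hP.2 a]; infer_instance⟩

variable [SecondCountableTopology H] [BorelSpace H]

theorem hasLaw (hP : IsGaussianWith P μ C) (a : H) :
    HasLaw (fun y => ⟪a, y⟫) (gaussianReal ⟪a, μ⟫ (Real.toNNReal ⟪C a, a⟫)) P :=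
  ⟨by fun_prop, hP.2 a⟩

theorem variance_inner (hP : IsGaussianWith P μ C) (a : H) :
    Var[fun y => ⟪a, y⟫; P] = ⟪C a, a⟫ := by
  rw [(hP.hasLaw a).variance_eq, variance_id_gaussianReal,
    Real.coe_toNNReal _ (hP.1.inner_nonneg_left a)]

theorem integral_inner (hP : IsGaussianWith P μ C) (a : H) : ∫ y, ⟪a, y⟫ ∂P = ⟪a, μ⟫ := by
  rw [(hP.hasLaw a).integral_eq, integral_id_gaussianReal]

theorem covariance_inner (hP : IsGaussianWith P μ C) (a b : H) :
    cov[fun y => ⟪a, y⟫, fun y => ⟪b, y⟫; P] = ⟪C a, b⟫ := by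
  have := hP.isGaussian
  have h := variance_fun_add (hP.hasGaussianLaw_inner a).memLp_two
    (hP.hasGaussianLaw_inner b).memLp_two
  simp_rw [← inner_add_left] at h
  rw [hP.variance_inner, hP.variance_inner, hP.variance_inner, map_add, inner_add_left,
    inner_add_right, inner_add_right, hP.1.inner_symm b a,
    real_inner_comm (C a) b] at h
  linarith

/-- Partial traces are expectations of partial sums of `∑ ⟪bᵢ, y - μ⟫² = ‖y - μ‖²`, and a Gaussian
measure has a finite second moment. -/
theorem isPosTraceClass (hP : IsGaussianWith P μ C) : IsPosTraceClass C := by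
  refine ⟨hP.1, fun s b => ?_⟩
  have := hP.isGaussian
  have hm : MemLp (fun y : H => y - μ) 2 P := (IsGaussian.memLp_two_id).sub (memLp_const μ)
  have hi : Integrable (fun y : H => ‖y - μ‖ ^ 2) P := hm.integrable_norm_pow two_ne_zero
  refine summable_of_sum_le (c := ∫ y, ‖y - μ‖ ^ 2 ∂P) (fun i => hP.1.inner_nonneg_left _)
    fun F => ?_
  have h1 : ∀ i, ⟪C (b i), b i⟫ = ∫ y, ⟪b i, y - μ⟫ ^ 2 ∂P := fun i => by
    rw [← hP.variance_inner, variance_eq_integral (by fun_prop), hP.integral_inner]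
    simp only [inner_sub_right]
  have h2 : ∀ i, Integrable (fun y => ⟪b i, y - μ⟫ ^ 2) P := fun i =>
    (hm.const_inner (𝕜 := ℝ) (b i)).integrable_sq
  simp only [h1]
  rw [← integral_finsetSum _ fun i _ => h2 i]
  exact integral_mono (integrable_finsetSum _ fun i _ => h2 i) hi fun y =>
    sum_le_hasSum _ (fun i _ => sq_nonneg _) (b.hasSum_inner_sq (y - μ))

/-- In an eigenbasis of `C` the coordinates are jointly Gaussian and uncorrelated, hence
independent, and the integral factors. -/
theorem integral_exp_neg_sum_eigenbasis {ι : Type*} {l : ι → ℝ} {σ : ℝ} (hσ : 0 < σ)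
    (hP : IsGaussianWith P μ C) (b : HilbertBasis ι ℝ H) (hb : ∀ i, C (b i) = l i • b i)
    (F : Finset ι) (x : H) :
    ∫ y, Real.exp (-σ * ∑ i ∈ F, ⟪b i, x - y⟫ ^ 2) ∂P =
      Real.exp (∑ i ∈ F, (-(1 / 2) * Real.log (1 + 2 * σ * l i) -
        σ * (⟪b i, x - μ⟫ ^ 2 / (1 + 2 * σ * l i)))) := by
  have := hP.isGaussian
  have hl : ∀ i, ⟪C (b i), b i⟫ = l i := fun i => by
    rw [hb, real_inner_smul_left, real_inner_self_eq_norm_sq, b.orthonormal.1 i]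
    simp
  have hind : iIndepFun (fun (i : F) (y : H) => ⟪b i, y⟫) P := by
    refine HasGaussianLaw.iIndepFun_of_covariance_eq_zero ?_ fun i j hij => ?_
    · exact (IsGaussian.hasGaussianLaw_id (μ := P)).map_fun
        (ContinuousLinearMap.pi fun i : F => innerSL ℝ (b i))
    · rw [hP.covariance_inner, hb, real_inner_smul_left,
        b.orthonormal.2 (fun h => hij (Subtype.ext h)), mul_zero]
  have h1 : ∀ y, Real.exp (-σ * ∑ i ∈ F, ⟪b i, x - y⟫ ^ 2) =
      ∏ i : F, Real.exp (-σ * (⟪b i, x⟫ - ⟪b i, y⟫) ^ 2) := fun y => by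
    rw [← Real.exp_sum, Finset.sum_coe_sort F (fun i => -σ * (⟪b i, x⟫ - ⟪b i, y⟫) ^ 2),
      Finset.mul_sum]
    simp only [inner_sub_right]
  simp_rw [h1]
  rw [hind.integral_fun_prod_comp (f := fun (i : F) z => Real.exp (-σ * (⟪b i, x⟫ - z) ^ 2))
    (fun i => by fun_prop) (fun i => by fun_prop), Real.exp_sum, ← Finset.prod_coe_sort F]
  refine Finset.prod_congr rfl fun i _ => ?_
  have h2 := (hP.hasLaw (b i)).integral_comp (f := fun z => Real.exp (-σ * (⟪b i, x⟫ - z) ^ 2))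
    (by fun_prop)
  simp only [Function.comp_def] at h2
  rw [h2, integral_exp_neg_mul_sq_gaussianReal hσ _ _ (hP.1.inner_nonneg_left _), hl,
    inner_sub_right]

theorem integral_exp_neg_mul_norm_sq {σ : ℝ} (hσ : 0 < σ) (hP : IsGaussianWith P μ C) (x : H) :
    ∫ y, Real.exp (-σ * ‖x - y‖ ^ 2) ∂P = detOneAdd ((2 * σ) • C) ^ (-(1 / 2) : ℝ) *
      Real.exp (-σ * ⟪Ring.inverse (1 + (2 * σ) • C) (x - μ), x - μ⟫) := by
  have := hP.isGaussian
  have htr := hP.isPosTraceClass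
  obtain ⟨s, b, hb⟩ := htr.exists_eigenbasis
  have hs := htr.2 s b
  have h0 : ∀ i, 0 ≤ ⟪C (b i), b i⟫ := fun i => hP.1.inner_nonneg_left _
  set l : s → ℝ := fun i => ⟪C (b i), b i⟫
  have hb' : ∀ i, ((2 * σ) • C) (b i) = (2 * σ * l i) • b i := fun i => by
    rw [smul_apply, hb, smul_smul]
  have h2σ : 0 ≤ 2 * σ := by positivity
  have : Countable s := b.orthonormal.countable
  rw [detOneAdd_rpow_eq_exp (htr.smul h2σ).1 b hb' (fun i => mul_nonneg h2σ (h0 i))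
    (hs.mul_left _), ← Real.exp_add]
  have hlim : Tendsto (fun F : Finset s => ∫ y, Real.exp (-σ * ∑ i ∈ F, ⟪b i, x - y⟫ ^ 2) ∂P)
      atTop (𝓝 (∫ y, Real.exp (-σ * ‖x - y‖ ^ 2) ∂P)) := by
    refine tendsto_integral_filter_of_dominated_convergence (fun _ => 1)
      (Eventually.of_forall fun F => by fun_prop) (Eventually.of_forall fun F => ?_)
      (integrable_const 1) (ae_of_all _ fun y => ?_)
    · refine ae_of_all _ fun y => ?_
      rw [Real.norm_eq_abs, Real.abs_exp, Real.exp_le_one_iff, neg_mul, neg_nonpos]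
      exact mul_nonneg hσ.le (Finset.sum_nonneg fun i _ => sq_nonneg _)
    · exact (Real.continuous_exp.tendsto _).comp
        ((b.hasSum_inner_sq (x - y) : Tendsto _ _ _).const_mul (-σ))
  simp_rw [hP.integral_exp_neg_sum_eigenbasis hσ b hb _ x] at hlim
  refine tendsto_nhds_unique hlim ((Real.continuous_exp.tendsto _).comp ?_)
  have hA := (Real.summable_log_one_add_of_summable (hs.mul_left (2 * σ))).hasSum.mul_left (-(1 / 2))
  have hB := (hasSum_inner_inverse_one_add_smul hP.1 b hb h0 h2σ (x - μ)).mul_left σ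
  rw [neg_mul σ, ← sub_eq_add_neg]
  exact hA.sub hB

theorem sub_prod {P₁ P₂ : Measure H} {μ₁ μ₂ : H} {C₁ C₂ : H →L[ℝ] H}
    (h₁ : IsGaussianWith P₁ μ₁ C₁) (h₂ : IsGaussianWith P₂ μ₂ C₂) :
    IsGaussianWith ((P₁.prod P₂).map fun p => p.1 - p.2) (μ₁ - μ₂) (C₁ + C₂) := by
  have := h₁.isGaussian
  have := h₂.isGaussian
  refine ⟨h₁.1.add h₂.1, fun a => ?_⟩
  rw [Measure.map_map (by fun_prop) (by fun_prop)]
  have hneg := h₂.2 (-a)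
  have he : (fun y => ⟪a, y⟫) ∘ (fun p : H × H => p.1 - p.2) =
      (fun q : ℝ × ℝ => q.1 + q.2) ∘ Prod.map (fun y => ⟪a, y⟫) (fun y => ⟪-a, y⟫) := by
    ext p
    simp [inner_sub_right, ← sub_eq_add_neg]
  rw [he, ← Measure.map_map (by fun_prop) (by fun_prop),
    ← Measure.map_prod_map _ _ (by fun_prop) (by fun_prop), h₁.2 a, hneg]
  change Measure.conv _ _ = _
  rw [gaussianReal_conv_gaussianReal, ← Real.toNNReal_add (h₁.1.inner_nonneg_left a)
    (h₂.1.inner_nonneg_left (-a))]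
  simp [inner_sub_right, inner_add_left, ← sub_eq_add_neg]

theorem eq_of_params {P₁ P₂ : Measure H} (h₁ : IsGaussianWith P₁ μ C)
    (h₂ : IsGaussianWith P₂ μ C) : P₁ = P₂ := by
  have := h₁.isGaussian
  have := h₂.isGaussian
  refine Measure.ext_of_charFun (funext fun t => ?_)
  rw [IsGaussian.charFun_eq, IsGaussian.charFun_eq, h₁.variance_inner, h₂.variance_inner,
    integral_complex_ofReal, integral_complex_ofReal, h₁.integral_inner, h₂.integral_inner]

end IsGaussianWith

end GaussianIntegral

/-! ### Kernel means in the Gaussian RKHS and the MMD -/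

section Embedding

variable {H : Type*} [NormedAddCommGroup H] [InnerProductSpace ℝ H] (σ : ℝ) [Fact (0 < σ)]

theorem inner_gaussFeature_left (x : H) (f : GaussRKHS H σ) : ⟪gaussFeature σ x, f⟫ = f x := by
  rw [gaussFeature, RKHS.kerFun_inner]
  simp

theorem gaussFeature_apply (x y : H) : gaussFeature σ y x = gaussK σ x y := by
  rw [gaussFeature, RKHS.kerFun_apply, RKHS.OfKernel.kernel_ofKernel]
  simp [gaussKMatrix]

theorem inner_gaussFeature (x y : H) : ⟪gaussFeature σ x, gaussFeature σ y⟫ = gaussK σ x y := by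
  rw [inner_gaussFeature_left, gaussFeature_apply]

theorem norm_gaussFeature (x : H) : ‖gaussFeature σ x‖ = 1 := by
  have h := inner_gaussFeature σ x x
  rw [real_inner_self_eq_norm_sq] at h
  rwa [gaussK, sub_self, norm_zero, zero_pow two_ne_zero, mul_zero, Real.exp_zero,
    pow_eq_one_iff_of_nonneg (norm_nonneg _) two_ne_zero] at h

theorem continuous_gaussFeature : Continuous (gaussFeature (H := H) σ) := by
  rw [continuous_iff_continuousAt]
  intro x
  rw [ContinuousAt, tendsto_iff_norm_sub_tendsto_zero]
  -- Features are unit vectors, so their distances are determined by the kernel, which is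
  -- continuous.
  have h : ∀ y, ‖gaussFeature σ y - gaussFeature σ x‖ = √(2 - 2 * gaussK σ y x) := fun y => by
    rw [← Real.sqrt_sq (norm_nonneg (gaussFeature σ y - gaussFeature σ x)), norm_sub_sq_real,
      norm_gaussFeature, norm_gaussFeature, inner_gaussFeature]
    congr 1
    ring
  simp_rw [h]
  have hc : Continuous fun y => √(2 - 2 * gaussK σ y x) := by
    unfold gaussK
    fun_prop
  simpa [gaussK] using hc.tendsto x

variable [SecondCountableTopology H] [MeasurableSpace H] [BorelSpace H]

theorem integrable_gaussFeature (P : Measure H) [IsFiniteMeasure P] :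
    Integrable (gaussFeature σ) P :=
  Integrable.of_bound (continuous_gaussFeature σ).aestronglyMeasurable 1
    (ae_of_all _ fun y => (norm_gaussFeature σ y).le)

theorem inner_kernelMean (P : Measure H) [IsFiniteMeasure P] (f : GaussRKHS H σ) :
    ⟪f, kernelMean σ P⟫ = ∫ y, f y ∂P := by
  rw [kernelMean, ← _root_.integral_inner (integrable_gaussFeature σ P)]
  simp_rw [real_inner_comm _ f, inner_gaussFeature_left]

theorem kernelMean_apply (P : Measure H) [IsFiniteMeasure P] (x : H) :
    kernelMean σ P x = ∫ y, gaussK σ x y ∂P := by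
  rw [← inner_gaussFeature_left, inner_kernelMean]
  simp_rw [gaussFeature_apply, gaussK, norm_sub_rev x]

/-- The inner product of two kernel means is the mean of the kernel under the law of the
difference. -/
theorem inner_kernelMean_kernelMean (P Q : Measure H) [IsProbabilityMeasure P]
    [IsProbabilityMeasure Q] :
    ⟪kernelMean σ P, kernelMean σ Q⟫ =
      ∫ z, Real.exp (-σ * ‖0 - z‖ ^ 2) ∂((P.prod Q).map fun p => p.1 - p.2) := by
  have hσ : 0 < σ := Fact.out
  rw [real_inner_comm, inner_kernelMean, integral_map (by fun_prop) (by fun_prop), integral_prod]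
  · simp_rw [kernelMean_apply, gaussK, zero_sub, norm_neg]
  · refine Integrable.of_bound (by fun_prop) 1 (ae_of_all _ fun p => ?_)
    rw [Real.norm_eq_abs, Real.abs_exp, Real.exp_le_one_iff, neg_mul, neg_nonpos]
    positivity

theorem gaussMMD_eq_norm_sub (P Q : Measure H) [IsFiniteMeasure P] [IsFiniteMeasure Q] :
    gaussMMD σ P Q = ‖kernelMean σ P - kernelMean σ Q‖ := by
  set d := kernelMean σ P - kernelMean σ Q with hd
  have h : ∀ f : GaussRKHS H σ, (∫ x, f x ∂P) - ∫ x, f x ∂Q = ⟪f, d⟫ := fun f => by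
    rw [hd, inner_sub_right, inner_kernelMean, inner_kernelMean]
  simp only [gaussMMD, h]
  have hle : ∀ f : {f : GaussRKHS H σ // ‖f‖ ≤ 1}, ⟪f.1, d⟫ ≤ ‖d‖ := fun f =>
    (real_inner_le_norm _ _).trans (mul_le_of_le_one_left (norm_nonneg _) f.2)
  have : Nonempty {f : GaussRKHS H σ // ‖f‖ ≤ 1} := ⟨⟨0, by simp⟩⟩
  refine le_antisymm (ciSup_le hle) ?_
  -- The supremum is attained at the normalised difference; for `d = 0` the convention `0⁻¹ = 0`
  -- makes this witness `0`, still in the unit ball.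
  have hn : ‖‖d‖⁻¹ • d‖ ≤ 1 := by
    rw [norm_smul, norm_inv, norm_norm]
    exact inv_mul_le_one
  refine le_of_eq_of_le ?_ (le_ciSup (f := fun f : {f : GaussRKHS H σ // ‖f‖ ≤ 1} => ⟪f.1, d⟫)
    ⟨‖d‖, Set.forall_mem_range.2 hle⟩ ⟨‖d‖⁻¹ • d, hn⟩)
  rw [real_inner_smul_left, real_inner_self_eq_norm_sq]
  by_cases h0 : ‖d‖ = 0
  · simp [h0]
  · field_simp

/-! ### Embeddings of Gaussian measures and injectivity -/

section Gaussian

variable [CompleteSpace H] {σ} {P₁ P₂ : Measure H} {μ₁ μ₂ : H} {C₁ C₂ : H →L[ℝ] H}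

theorem IsGaussianWith.inner_kernelMean (h₁ : IsGaussianWith P₁ μ₁ C₁)
    (h₂ : IsGaussianWith P₂ μ₂ C₂) :
    ⟪kernelMean σ P₁, kernelMean σ P₂⟫ = detOneAdd ((2 * σ) • (C₁ + C₂)) ^ (-(1 / 2) : ℝ) *
      Real.exp (-σ * ⟪Ring.inverse (1 + (2 * σ) • (C₁ + C₂)) (μ₁ - μ₂), μ₁ - μ₂⟫) := by
  have := h₁.isGaussian
  have := h₂.isGaussian
  rw [inner_kernelMean_kernelMean,
    (h₁.sub_prod h₂).integral_exp_neg_mul_norm_sq (Fact.out : 0 < σ) 0]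
  simp only [zero_sub, map_neg, inner_neg_neg]

theorem IsGaussianWith.norm_kernelMean_sq (h₁ : IsGaussianWith P₁ μ₁ C₁) :
    ‖kernelMean σ P₁‖ ^ 2 = detOneAdd ((4 * σ) • C₁) ^ (-(1 / 2) : ℝ) := by
  rw [← real_inner_self_eq_norm_sq, h₁.inner_kernelMean h₁, ← two_smul ℝ C₁, smul_smul]
  simp only [sub_self, map_zero, inner_zero_left, mul_zero, Real.exp_zero, mul_one]
  ring_nf

theorem IsGaussianWith.norm_kernelMean_sub_sq (h₁ : IsGaussianWith P₁ μ₁ C₁)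
    (h₂ : IsGaussianWith P₂ μ₂ C₂) :
    ‖kernelMean σ P₁ - kernelMean σ P₂‖ ^ 2 =
      detOneAdd ((4 * σ) • C₁) ^ (-(1 / 2) : ℝ) + detOneAdd ((4 * σ) • C₂) ^ (-(1 / 2) : ℝ) -
        2 * detOneAdd ((2 * σ) • (C₁ + C₂)) ^ (-(1 / 2) : ℝ) *
          Real.exp (-σ * ⟪Ring.inverse (1 + (2 * σ) • (C₁ + C₂)) (μ₁ - μ₂), μ₁ - μ₂⟫) := by
  rw [norm_sub_sq_real, h₁.norm_kernelMean_sq, h₂.norm_kernelMean_sq, h₁.inner_kernelMean h₂]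
  ring

theorem injOn_kernelMean_gaussian (σ : ℝ) [Fact (0 < σ)] : Set.InjOn (fun P : Measure H => kernelMean σ P)
    {P : Measure H | ∃ (μ : H) (C : H →L[ℝ] H), IsGaussianWith P μ C} := by
  have hσ : 0 < σ := Fact.out
  rintro P₁ ⟨μ₁, C₁, h₁⟩ P₂ ⟨μ₂, C₂, h₂⟩ heq
  have hn := h₁.norm_kernelMean_sub_sq (σ := σ) h₂
  rw [sub_eq_zero.2 heq, norm_zero, zero_pow two_ne_zero] at hn
  have hC := h₁.1.add h₂.1
  have h2σ : 0 ≤ 2 * σ := by positivity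
  obtain ⟨hinv, hcancel⟩ := inner_inverse_one_add_smul hC h2σ (μ₁ - μ₂)
  set q := ⟪Ring.inverse (1 + (2 * σ) • (C₁ + C₂)) (μ₁ - μ₂), μ₁ - μ₂⟫
  have hq : 0 ≤ q := (sq_nonneg _).trans hinv
  have hexp : Real.exp (-σ * q) ≤ 1 := by
    rw [Real.exp_le_one_iff, neg_mul, neg_nonpos]
    positivity
  have t₁ := h₁.isPosTraceClass.smul (show 0 ≤ 4 * σ by positivity)
  have t₂ := h₂.isPosTraceClass.smul (show 0 ≤ 4 * σ by positivity)
  -- The operator in the cross term is the midpoint of the other two, so with `exp (-σ q) ≤ 1` a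
  -- zero distance contradicts strict convexity unless `C₁ = C₂`.
  have hmid : (2 * σ) • (C₁ + C₂) =
      (1 / 2 : ℝ) • ((4 * σ) • C₁) + (1 / 2 : ℝ) • ((4 * σ) • C₂) := by module
  have hpos : 0 < detOneAdd ((2 * σ) • (C₁ + C₂)) ^ (-(1 / 2) : ℝ) := by
    have t := (h₁.isPosTraceClass.add h₂.isPosTraceClass).smul h2σ
    obtain ⟨s, b, hb⟩ := t.exists_eigenbasis
    rw [detOneAdd_rpow_eq_exp t.1 b hb (fun i => t.1.inner_nonneg_left _) (t.2 s b)]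
    exact Real.exp_pos _
  have hCC : C₁ = C₂ := by
    by_contra hne
    have hne' : (4 * σ) • C₁ ≠ (4 * σ) • C₂ := fun h =>
      hne (smul_right_injective _ (by positivity : 4 * σ ≠ 0) h)
    have hs := (strictConvexOn_detOneAdd_rpow (H := H)).2 t₁ t₂ hne'
      (by norm_num : (0 : ℝ) < 1 / 2) (by norm_num : (0 : ℝ) < 1 / 2) (by norm_num)
    simp only [← hmid, smul_eq_mul] at hs
    nlinarith
  subst hCC
  have hsame : (2 * σ) • (C₁ + C₁) = (4 * σ) • C₁ := by module
  rw [← hsame] at hn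
  -- With equal covariances the distance formula reads `2 F (1 - exp (-σ q)) = 0` with `F > 0`, so
  -- `q = 0`; since `q` dominates `‖(I + 4σC₁)⁻¹ (μ₁ - μ₂)‖²`, the means coincide.
  have he : Real.exp (-σ * q) = 1 := by
    have := hpos.ne'
    refine mul_left_cancel₀ this ?_
    linarith
  rw [Real.exp_eq_one_iff, neg_mul, neg_eq_zero] at he
  have hq0 : q = 0 := (mul_eq_zero.1 he).resolve_left hσ.ne'
  have hu : Ring.inverse (1 + (2 * σ) • (C₁ + C₁)) (μ₁ - μ₂) = 0 := by
    rw [hq0] at hinv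
    simpa using le_antisymm hinv (sq_nonneg _)
  rw [hu, map_zero] at hcancel
  have hμ : μ₁ = μ₂ := sub_eq_zero.1 hcancel.symm
  subst hμ
  exact h₁.eq_of_params h₂

end Gaussian

end Embedding

/-- Kernel mean embedding of Gaussian measures on a separable Hilbert space. -/
theorem mainTheorem4 {H : Type*} [NormedAddCommGroup H] [InnerProductSpace ℝ H] [CompleteSpace H]
    [SecondCountableTopology H] [MeasurableSpace H] [BorelSpace H] (σ : ℝ) [Fact (0 < σ)] :
    -- `|I + A|` is given by a convergent product over eigenvalues of finite multiplicity,
    -- and `A ↦ |I + A|^{-1/2}` is strictly convex on the positive trace-class operators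
    (∀ A : H →L[ℝ] H, IsPosTraceClass A →
        (∀ t : ℝ, t ≠ 0 → FiniteDimensional ℝ (Module.End.eigenspace (A : H →ₗ[ℝ] H) t)) ∧
        Multipliable fun t : ℝ => (1 + t) ^ eigenMult A t) ∧
    StrictConvexOn ℝ {A : H →L[ℝ] H | IsPosTraceClass A}
      (fun A => detOneAdd A ^ (-(1 / 2) : ℝ)) ∧
    -- the kernel mean function and its norm
    (∀ (P : Measure H) (μ : H) (C : H →L[ℝ] H), IsGaussianWith P μ C →
        IsPosTraceClass C ∧
        IsUnit (1 + (2 * σ) • C) ∧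
        Integrable (gaussFeature σ) P ∧
        (∀ x : H, kernelMean σ P x = ∫ y, Real.exp (-σ * ‖x - y‖ ^ 2) ∂P) ∧
        (∀ x : H, ∫ y, Real.exp (-σ * ‖x - y‖ ^ 2) ∂P =
          detOneAdd ((2 * σ) • C) ^ (-(1 / 2) : ℝ) *
            Real.exp (-σ * ⟪Ring.inverse (1 + (2 * σ) • C) (x - μ), x - μ⟫)) ∧
        ‖kernelMean σ P‖ ^ 2 = detOneAdd ((4 * σ) • C) ^ (-(1 / 2) : ℝ)) ∧
    -- the maximum mean discrepancy of two Gaussian measures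
    (∀ (P₁ P₂ : Measure H) (μ₁ μ₂ : H) (C₁ C₂ : H →L[ℝ] H),
        IsGaussianWith P₁ μ₁ C₁ → IsGaussianWith P₂ μ₂ C₂ →
        IsUnit (1 + (2 * σ) • (C₁ + C₂)) ∧
        gaussMMD σ P₁ P₂ = ‖kernelMean σ P₁ - kernelMean σ P₂‖ ∧
        ‖kernelMean σ P₁ - kernelMean σ P₂‖ ^ 2 =
          detOneAdd ((4 * σ) • C₁) ^ (-(1 / 2) : ℝ) + detOneAdd ((4 * σ) • C₂) ^ (-(1 / 2) : ℝ) -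
            2 * detOneAdd ((2 * σ) • (C₁ + C₂)) ^ (-(1 / 2) : ℝ) *
              Real.exp (-σ * ⟪Ring.inverse (1 + (2 * σ) • (C₁ + C₂)) (μ₁ - μ₂), μ₁ - μ₂⟫)) ∧
    -- injectivity of the kernel mean embedding on Gaussian measures
    Set.InjOn (fun P : Measure H => kernelMean σ P)
      {P : Measure H | ∃ (μ : H) (C : H →L[ℝ] H), IsGaussianWith P μ C} := by
  have hσ : 0 < σ := Fact.out
  refine ⟨fun A hA => ⟨fun t ht => hA.finiteDimensional_eigenspace ht, hA.multipliable⟩,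
    strictConvexOn_detOneAdd_rpow, fun P μ C hP => ?_, fun P₁ P₂ μ₁ μ₂ C₁ C₂ h₁ h₂ => ?_,
    injOn_kernelMean_gaussian σ⟩
  · have := hP.isGaussian
    exact ⟨hP.isPosTraceClass, hP.1.isUnit_one_add_smul (by positivity),
      integrable_gaussFeature σ P, kernelMean_apply σ P,
      hP.integral_exp_neg_mul_norm_sq hσ, hP.norm_kernelMean_sq⟩
  · have := h₁.isGaussian
    have := h₂.isGaussian
    exact ⟨(h₁.1.add h₂.1).isUnit_one_add_smul (by positivity), gaussMMD_eq_norm_sub σ P₁ P₂,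
      h₁.norm_kernelMean_sub_sq h₂⟩
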